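/- **Asymmetric hub model.** There are $n$ nodes, the first $n_L\le n$ of which are the possible hubs. The parameters are $\rho=(\rho_1,\dots,\rho_{n_L})$ with $\rho_i\ge 0$, $\sum_i\rho_i=1$, and an $n_L\times n$ matrix $A$ with entries in $[0,1]$ and $A_{ii}=1$ for $i\le n_L$. One observes $T$ independent groups $G^{(t)}\in\{0,1\}^n$: a latent hub $z_*^{(t)}$ is drawn with $\mathbb P(z_*^{(t)}=i)=\rho_i$, and given $z_*^{(t)}=i$ the coordinates $G^{(t)}_j$ are independent with $\mathbb P(G_j^{(t)}=1\mid z_*^{(t)}=i)=A_{ij}$. For an assignment $z\in\{1,\dots,n_L\}^T$ let $$L_G(z)=\max_{B}\ \sum_{t=1}^T\sum_{j=1}^n\Big(G_j^{(t)}\log B_{z^{(t)}j}+(1-G_j^{(t)})\log(1-B_{z^{(t)}j})\Big)$$ ($\log 0=-\infty$, $0\cdot\log 0=0$), the maximum being over $n_L\times n$ matrices $B$ with entries in $[0,1]$ and $B_{ii}=1$ for $i\le n_L$. Let $\hat z$ be any maximizer of $L_G$, and let $T_e=\#\{t: \hat z^{(t)}\ne z_*^{(t)}\}$. The sizes $n_L,n,T$,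 the parameters $\rho,A$ and the numbers $d,v>0$ may all vary along the asymptotics. Assume throughout that there are constants $c_{\min},c_{\max}>0$ with $c_{\min}/n_L\le\rho_i\le c_{\max}/n_L$ for all $i$, and that (i) there are sets $V_i\subset\{1,\dots,n\}$, $i=1,\dots,n_L$, with $|V_i|\ge vn/n_L$ and $A_{ij}-A_{i'j}\ge d$ for all $j\in V_i$ and $i'\ne i$. **Theorem 4.** Suppose that, for some constant $c_0>0$, $A_{ii'}\le c_0/n_L$ for all distinct $i,i'\le n_L$. If $n_L^2\log n_L/T\to0$, $n_L^2\log T/(d^2vT)\to0$ and $n_L^2\log n_L/(d^4v^2n)\to0$, then $T_e/T=o_p(1)$, i.e. $\mathbb P(T_e/T\ge\varepsilon)\to0$ for every $\varepsilon>0$, as $n_L,n,T\to\infty$. **Theorem 4′.** Let $n_L$ be fixed and suppose that $A_{ii'}\le c$ for all distinct $i,i'\le n_L$, with a constant $c<1$. If $\log T/(d^2vT)\to0$ and $d^4v^2n\to\infty$, then $T_e/T=o_p(1)$ as $n,T\to\infty$. **Theorem 4″.** Let $n_L$ be fixed, suppose that $A_{ii'}\le c$ for all distinct $i,i'\le n_L$,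 with a constant $c<1$, and let $d$ and $v$ be constants. Then $T_e/T=o_p(1)$ as $n,T\to\infty$. -/

import Mathlib

open MeasureTheory ProbabilityTheory Filter Topology

noncomputable section

namespace HubModel

/-- The matrices `A` of size `nL × n` that are admissible in the asymmetric hub model: entries in
`[0, 1]`, and `A i i = 1` for every hub `i`. Hubs are the first `nL` of the `n` nodes. -/
def Admissible {nL n : ℕ} (h : nL ≤ n) : Set (Matrix (Fin nL) (Fin n) ℝ) :=
  {A | (∀ i j, A i j ∈ Set.Icc (0 : ℝ) 1) ∧ ∀ i, A i (Fin.castLE h i) = 1}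

/-- Parameters `(ρ, A)` of the asymmetric hub model with `n` nodes and hub set the first `nL`. -/
structure Params (nL n : ℕ) where
  le : nL ≤ n
  ρ : Fin nL → ℝ
  A : Matrix (Fin nL) (Fin n) ℝ
  ρ_nonneg : ∀ i, 0 ≤ ρ i
  ρ_sum : ∑ i, ρ i = 1
  A_mem : A ∈ Admissible le

/-- The probability that a Bernoulli variable with parameter `p` takes the value `b`. -/
def bern (p : ℝ) (b : Bool) : ℝ := if b then p else 1 - p

/-- `(zs, G)` is a sample of `T` groups with their hubs: `zs ω t` is the true hub of group `t`, and
`G ω t j` tells whether node `j` appears in group `t`. The pairs (hub, group) are independent over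
`t`; the hub is drawn from `ρ` and, given that the hub is `i`, the nodes `j` appear independently
with probabilities `A i j`. -/
structure IsSample {nL n T : ℕ} (P : Params nL n) {Ω : Type*} [MeasurableSpace Ω] (μ : Measure Ω)
    (zs : Ω → Fin T → Fin nL) (G : Ω → Fin T → Fin n → Bool) : Prop where
  measurable_zs : Measurable zs
  measurable_G : Measurable G
  indep : iIndepFun (fun (t : Fin T) (ω : Ω) => (zs ω t, G ω t)) μ
  law : ∀ (t : Fin T) (i : Fin nL) (g : Fin n → Bool),
    μ.real {ω | zs ω t = i ∧ G ω t = g} = P.ρ i * ∏ j, bern (P.A i j) (g j)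

/-- The log-likelihood `L_G(A | z)` of the data `g` given the hub assignment `z`, with values in the
extended reals so that `log 0 = -∞`. -/
def condLogLik {nL n T : ℕ} (g : Fin T → Fin n → Bool) (A : Matrix (Fin nL) (Fin n) ℝ)
    (z : Fin T → Fin nL) : EReal :=
  ∑ t, ∑ j, ENNReal.log (ENNReal.ofReal (bern (A (z t) j) (g t j)))

/-- The profile log-likelihood `L_G(z)`: the maximum of `L_G(A | z)` over the admissible `A`. -/
def profileLogLik {nL n T : ℕ} (h : nL ≤ n) (g : Fin T → Fin n → Bool)
    (z : Fin T → Fin nL) : EReal :=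
  ⨆ A ∈ Admissible h, condLogLik g A z

/-- `z` is a maximizer of the profile log-likelihood of the data `g`. -/
def IsMaxProfile {nL n T : ℕ} (h : nL ≤ n) (g : Fin T → Fin n → Bool)
    (z : Fin T → Fin nL) : Prop :=
  ∀ z' : Fin T → Fin nL, profileLogLik h g z' ≤ profileLogLik h g z

/-- The number `T_e` of groups whose hub label in `z'` differs from that in `z`. -/
def numErrors {nL T : ℕ} (z z' : Fin T → Fin nL) : ℕ :=
  (Finset.univ.filter fun t => z t ≠ z' t).card

/-- Every hub `i` has a set `V i` of at least `v * n / nL` nodes, each of which prefers hub `i` to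
any other hub by a margin of at least `d`. -/
def Separated {nL n : ℕ} (P : Params nL n) (d v : ℝ) : Prop :=
  ∃ V : Fin nL → Finset (Fin n), ∀ i, v * n / nL ≤ ((V i).card : ℝ) ∧
    ∀ j ∈ V i, ∀ i', i ≠ i' → d ≤ P.A i j - P.A i' j

/-- `A i i' ≤ c` for all pairs of distinct hubs. -/
def HubBound {nL n : ℕ} (P : Params nL n) (c : ℝ) : Prop :=
  ∀ i i' : Fin nL, i ≠ i' → P.A i (Fin.castLE P.le i') ≤ c

end HubModel

end

/-
For a fixed assignment `z` and matrix `B`, the probability that `(B, z)` is at least as likely as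
the truth is bounded by the Bhattacharyya coefficient of the two product Bernoulli laws, hence by
`exp (-S / 8)` with `S` the squared distance between the two arrays of success probabilities. By
separation, `S` is bounded below by the number of errors left after the best relabelling of `z`. The
profile likelihood of `z` is attained at a matrix of class frequencies, and there are at most
`(T + 1) ^ (nL * n)` of these, so a union bound brings `zhat` close to a relabelling of the true
hubs. Finally, a maximizer must give every group one of its own members as hub; since group `t`
typically contains few hubs besides its own, this pins the relabelling down to the identity.
-/

noncomputable section

namespace HubModel

open scoped Finset

section Bernoulli

theorem bern_nonneg {p : ℝ} (hp : p ∈ Set.Icc (0 : ℝ) 1) (b : Bool) : 0 ≤ bern p b := by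
  cases b
  · exact sub_nonneg.2 hp.2
  · exact hp.1

theorem sum_bern (p : ℝ) : ∑ b, bern p b = 1 := by simp [bern]

theorem pow_le_pow_mul_exp_sub (k : ℕ) {y : ℝ} (hy : 0 ≤ y) :
    y ^ k ≤ (k : ℝ) ^ k * Real.exp (y - k) := by
  rcases Nat.eq_zero_or_pos k with rfl | hk
  · simpa using hy
  have : (0 : ℝ) < k := by exact_mod_cast hk
  have hbase : y ≤ k * Real.exp (y / k - 1) :=
    calc y = k * (y / k - 1 + 1) := by field_simp; ring
      _ ≤ k * Real.exp (y / k - 1) := by gcongr; exact Real.add_one_le_exp _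
  calc y ^ k ≤ (k * Real.exp (y / k - 1)) ^ k := by gcongr
    _ = (k : ℝ) ^ k * Real.exp (y - k) := by
        rw [mul_pow, ← Real.exp_nat_mul]
        congr 2
        field_simp

theorem pow_mul_one_sub_pow_le (s r : ℕ) {p : ℝ} (hp : p ∈ Set.Icc (0 : ℝ) 1) :
    p ^ s * (1 - p) ^ r ≤ ((s : ℝ) / (s + r : ℕ)) ^ s * (1 - (s : ℝ) / (s + r : ℕ)) ^ r := by
  rcases Nat.eq_zero_or_pos (s + r) with h0 | hpos
  · obtain ⟨rfl, rfl⟩ : s = 0 ∧ r = 0 := by omega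
    simp
  set N : ℝ := ((s + r : ℕ) : ℝ) with hN
  have hN0 : 0 < N := by rw [hN]; exact_mod_cast hpos
  have hr : 1 - s / N = r / N := by
    rw [one_sub_div hN0.ne', hN]; push_cast; ring
  have hs_le := pow_le_pow_mul_exp_sub s (mul_nonneg hN0.le hp.1)
  have hr_le := pow_le_pow_mul_exp_sub r (mul_nonneg hN0.le (sub_nonneg.2 hp.2))
  have hexp : Real.exp (N * p - s) * Real.exp (N * (1 - p) - r) = 1 := by
    rw [← Real.exp_add, Real.exp_eq_one_iff, hN]; push_cast; ring
  rw [hr, div_pow, div_pow, div_mul_div_comm, le_div_iff₀ (by positivity)]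
  calc p ^ s * (1 - p) ^ r * (N ^ s * N ^ r) = (N * p) ^ s * (N * (1 - p)) ^ r := by
        rw [mul_pow, mul_pow]; ring
    _ ≤ ((s : ℝ) ^ s * Real.exp (N * p - s)) * ((r : ℝ) ^ r * Real.exp (N * (1 - p) - r)) :=
        mul_le_mul hs_le hr_le (pow_nonneg (mul_nonneg hN0.le (sub_nonneg.2 hp.2)) _)
          (by positivity)
    _ = (s : ℝ) ^ s * (r : ℝ) ^ r := by rw [mul_mul_mul_comm, hexp, mul_one]

theorem prod_bern_eq {α : Type*} (s : Finset α) (b : α → Bool) (p : ℝ) :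
    ∏ t ∈ s, bern p (b t) = p ^ #{t ∈ s | b t} * (1 - p) ^ #{t ∈ s | ¬ b t} := by
  simp only [bern, Finset.prod_ite, Finset.prod_const]

theorem prod_bern_le_prod_bern_freq {α : Type*} (s : Finset α) (b : α → Bool) {p : ℝ}
    (hp : p ∈ Set.Icc (0 : ℝ) 1) :
    ∏ t ∈ s, bern p (b t) ≤ ∏ t ∈ s, bern (#{t ∈ s | b t} / #s) (b t) := by
  rw [prod_bern_eq, prod_bern_eq]
  have h := pow_mul_one_sub_pow_le #{t ∈ s | b t} #{t ∈ s | ¬ b t} hp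
  rwa [Finset.card_filter_add_card_filter_not] at h

theorem sum_sqrt_bern_mul_bern_le_exp {p q : ℝ} (hp : p ∈ Set.Icc (0 : ℝ) 1)
    (hq : q ∈ Set.Icc (0 : ℝ) 1) :
    ∑ b, √(bern p b * bern q b) ≤ Real.exp (-(p - q) ^ 2 / 8) := by
  have hp' := sub_nonneg.2 hp.2
  have hq' := sub_nonneg.2 hq.2
  have hsum : ∑ b, √(bern p b * bern q b) = √p * √q + √(1 - p) * √(1 - q) := by
    simp [bern, Real.sqrt_mul hp.1, Real.sqrt_mul hp']
  have hadd : (√p + √q) ^ 2 ≤ 4 := by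
    nlinarith [Real.sqrt_le_one.2 hp.2, Real.sqrt_le_one.2 hq.2, Real.sqrt_nonneg p,
      Real.sqrt_nonneg q]
  have hsub : (p - q) ^ 2 ≤ 4 * (√p - √q) ^ 2 :=
    calc (p - q) ^ 2 = (√p ^ 2 - √q ^ 2) ^ 2 := by rw [Real.sq_sqrt hp.1, Real.sq_sqrt hq.1]
      _ = (√p + √q) ^ 2 * (√p - √q) ^ 2 := by ring
      _ ≤ 4 * (√p - √q) ^ 2 := by gcongr
  rw [hsum]
  refine le_trans ?_ (Real.add_one_le_exp _)
  nlinarith [sq_nonneg (√(1 - p) - √(1 - q)), Real.sq_sqrt hp.1, Real.sq_sqrt hq.1,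
    Real.sq_sqrt hp', Real.sq_sqrt hq']

variable {κ : Type*} [Fintype κ]

/-- The probability of the outcome `x` of independent Bernoulli variables with parameters `p`. -/
def bernProd (p : κ → ℝ) (x : κ → Bool) : ℝ := ∏ k, bern (p k) (x k)

theorem bernProd_nonneg {p : κ → ℝ} (hp : ∀ k, p k ∈ Set.Icc (0 : ℝ) 1) (x : κ → Bool) :
    0 ≤ bernProd p x :=
  Finset.prod_nonneg fun k _ => bern_nonneg (hp k) _

theorem sum_bernProd_filter_eq [DecidableEq κ] (p : κ → ℝ) (k : κ) (b : Bool) :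
    ∑ x with x k = b, bernProd p x = bern (p k) b := by
  have hset : ({x | x k = b} : Finset (κ → Bool))
      = Fintype.piFinset (Function.update (fun _ => (Finset.univ : Finset Bool)) k {b}) := by
    rw [Fintype.piFinset_update_singleton_eq_filter_piFinset_eq (fun _ => Finset.univ) k
      (Finset.mem_univ b),
      Fintype.piFinset_univ]
  simp only [bernProd]
  rw [hset, ← Finset.prod_univ_sum, Fintype.prod_eq_single k]
  · simp
  · intro j hj
    rw [Function.update_of_ne hj, sum_bern]

theorem bernProd_le_prod_sqrt {p q : κ → ℝ} (hp : ∀ k, p k ∈ Set.Icc (0 : ℝ) 1)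
    (hq : ∀ k, q k ∈ Set.Icc (0 : ℝ) 1) {x : κ → Bool} (hx : bernProd p x ≤ bernProd q x) :
    bernProd p x ≤ ∏ k, √(bern (p k) (x k) * bern (q k) (x k)) := by
  rw [← Real.sqrt_prod _ fun k _ => mul_nonneg (bern_nonneg (hp k) _) (bern_nonneg (hq k) _),
    Finset.prod_mul_distrib]
  exact Real.le_sqrt_of_sq_le
    ((sq _).trans_le (mul_le_mul_of_nonneg_left hx (bernProd_nonneg hp x)))

theorem sum_bernProd_filter_le_exp [DecidableEq κ] {p q : κ → ℝ} (hp : ∀ k, p k ∈ Set.Icc (0 : ℝ) 1)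
    (hq : ∀ k, q k ∈ Set.Icc (0 : ℝ) 1) :
    ∑ x with bernProd p x ≤ bernProd q x, bernProd p x
      ≤ Real.exp (-(∑ k, (p k - q k) ^ 2) / 8) := by
  calc ∑ x with bernProd p x ≤ bernProd q x, bernProd p x
      ≤ ∑ x with bernProd p x ≤ bernProd q x, ∏ k, √(bern (p k) (x k) * bern (q k) (x k)) :=
        Finset.sum_le_sum fun x hx => bernProd_le_prod_sqrt hp hq (Finset.mem_filter.1 hx).2
    _ ≤ ∑ x : κ → Bool, ∏ k, √(bern (p k) (x k) * bern (q k) (x k)) :=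
        Finset.sum_le_univ_sum_of_nonneg fun x => Finset.prod_nonneg fun k _ => Real.sqrt_nonneg _
    _ = ∏ k, ∑ b, √(bern (p k) b * bern (q k) b) :=
        (Fintype.prod_sum fun k b => √(bern (p k) b * bern (q k) b)).symm
    _ ≤ ∏ k, Real.exp (-(p k - q k) ^ 2 / 8) :=
        Finset.prod_le_prod (fun k _ => Finset.sum_nonneg fun b _ => Real.sqrt_nonneg _)
          fun k _ => sum_sqrt_bern_mul_bern_le_exp (hp k) (hq k)
    _ = Real.exp (-(∑ k, (p k - q k) ^ 2) / 8) := by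
        rw [← Real.exp_sum, ← Finset.sum_div, Finset.sum_neg_distrib]

end Bernoulli

section Likelihood

variable {nL n T : ℕ} {A B : Matrix (Fin nL) (Fin n) ℝ}

/-- The likelihood of the data `g` given the hub assignment `z` and the matrix `A`. -/
def lik (g : Fin T → Fin n → Bool) (A : Matrix (Fin nL) (Fin n) ℝ) (z : Fin T → Fin nL) : ℝ :=
  bernProd (fun q : Fin T × Fin n => A (z q.1) q.2) fun q => g q.1 q.2

theorem lik_eq_prod_bernProd (g : Fin T → Fin n → Bool) (A : Matrix (Fin nL) (Fin n) ℝ)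
    (z : Fin T → Fin nL) : lik g A z = ∏ t, bernProd (A (z t)) (g t) := by
  simp only [lik, bernProd, Fintype.prod_prod_type]

theorem lik_nonneg (hA : ∀ i j, A i j ∈ Set.Icc (0 : ℝ) 1) (g : Fin T → Fin n → Bool)
    (z : Fin T → Fin nL) : 0 ≤ lik g A z :=
  bernProd_nonneg (fun _ => hA _ _) _

theorem sum_log_ofReal {α : Type*} (s : Finset α) {f : α → ℝ} (hf : ∀ a ∈ s, 0 ≤ f a) :
    ∑ a ∈ s, ENNReal.log (ENNReal.ofReal (f a))
      = ENNReal.log (ENNReal.ofReal (∏ a ∈ s, f a)) := by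
  classical
  induction s using Finset.induction_on with
  | empty => simp
  | insert a s ha ih =>
    have hs := fun b hb => hf b (Finset.mem_insert_of_mem hb)
    rw [Finset.sum_insert ha, Finset.prod_insert ha, ih hs,
      ENNReal.ofReal_mul (hf a (Finset.mem_insert_self a s)), ENNReal.log_mul_add]

theorem condLogLik_eq_log_lik (hA : ∀ i j, A i j ∈ Set.Icc (0 : ℝ) 1)
    (g : Fin T → Fin n → Bool) (z : Fin T → Fin nL) :
    condLogLik g A z = ENNReal.log (ENNReal.ofReal (lik g A z)) := by
  rw [lik, bernProd, ← sum_log_ofReal _ fun _ _ => bern_nonneg (hA _ _) _,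
    Fintype.sum_prod_type, condLogLik]

theorem sum_filter_lik_le_exp (hA : ∀ i j, A i j ∈ Set.Icc (0 : ℝ) 1)
    (hB : ∀ i j, B i j ∈ Set.Icc (0 : ℝ) 1) (z₀ z : Fin T → Fin nL) :
    ∑ g with lik g A z₀ ≤ lik g B z, lik g A z₀
      ≤ Real.exp (-(∑ t, ∑ j, (A (z₀ t) j - B (z t) j) ^ 2) / 8) := by
  rw [← Fintype.sum_prod_type' fun t j => (A (z₀ t) j - B (z t) j) ^ 2]
  refine le_of_eq_of_le ?_ (sum_bernProd_filter_le_exp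
    (p := fun q : Fin T × Fin n => A (z₀ q.1) q.2) (q := fun q => B (z q.1) q.2)
    (fun _ => hA _ _) fun _ => hB _ _)
  simp only [Finset.sum_filter]
  exact (Equiv.curry (Fin T) (Fin n) Bool).symm.sum_comp fun x =>
    if bernProd (fun q => A (z₀ q.1) q.2) x ≤ bernProd (fun q => B (z q.1) q.2) x
    then bernProd (fun q => A (z₀ q.1) q.2) x else 0

/-- The maximum likelihood estimator of `A` given the hub assignment `z`: the frequency with which
node `j` appears in the groups assigned to hub `i`, with the value `0` if there is no such group. -/
def empMatrix (g : Fin T → Fin n → Bool) (z : Fin T → Fin nL) : Matrix (Fin nL) (Fin n) ℝ :=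
  fun i j => #{t | z t = i ∧ g t j} / #{t | z t = i}

theorem empMatrix_mem_Icc (g : Fin T → Fin n → Bool) (z : Fin T → Fin nL) (i : Fin nL)
    (j : Fin n) : empMatrix g z i j ∈ Set.Icc (0 : ℝ) 1 := by
  refine ⟨by unfold empMatrix; positivity, div_le_one_of_le₀ ?_ (by positivity)⟩
  exact Nat.cast_le.2 (Finset.card_le_card (Finset.monotone_filter_right _ fun _ _ => And.left))

theorem lik_eq_prod_fiber (g : Fin T → Fin n → Bool) (A : Matrix (Fin nL) (Fin n) ℝ)
    (z : Fin T → Fin nL) : lik g A z = ∏ j, ∏ i, ∏ t with z t = i, bern (A i j) (g t j) := by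
  rw [lik, bernProd, Fintype.prod_prod_type_right]
  refine Fintype.prod_congr _ _ fun j => ?_
  rw [← Finset.prod_fiberwise Finset.univ z]
  refine Fintype.prod_congr _ _ fun i => Finset.prod_congr rfl fun t ht => ?_
  rw [(Finset.mem_filter.1 ht).2]

theorem lik_le_lik_empMatrix (hA : ∀ i j, A i j ∈ Set.Icc (0 : ℝ) 1)
    (g : Fin T → Fin n → Bool) (z : Fin T → Fin nL) : lik g A z ≤ lik g (empMatrix g z) z := by
  rw [lik_eq_prod_fiber, lik_eq_prod_fiber]
  have hnonneg : ∀ i j, 0 ≤ ∏ t with z t = i, bern (A i j) (g t j) := fun i j =>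
    Finset.prod_nonneg fun t _ => bern_nonneg (hA i j) _
  refine Finset.prod_le_prod (fun j _ => Finset.prod_nonneg fun i _ => hnonneg i j) fun j _ =>
    Finset.prod_le_prod (fun i _ => hnonneg i j) fun i _ => ?_
  simpa only [empMatrix, Finset.filter_filter] using
    prod_bern_le_prod_bern_freq {t | z t = i} (fun t => g t j) (hA i j)

theorem card_image_empMatrix_le [DecidableEq (Matrix (Fin nL) (Fin n) ℝ)] (z : Fin T → Fin nL) :
    #(Finset.univ.image fun g : Fin T → Fin n → Bool => empMatrix g z) ≤ (T + 1) ^ (nL * n) := by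
  have hsub : (Finset.univ.image fun g : Fin T → Fin n → Bool => empMatrix g z) ⊆
      Finset.univ.image fun (K : Fin nL → Fin n → Fin (T + 1)) i j =>
        ((K i j : ℕ) / #{t | z t = i} : ℝ) := by
    refine Finset.image_subset_iff.2 fun g _ => Finset.mem_image.2
      ⟨fun i j => ⟨#{t | z t = i ∧ g t j}, ?_⟩, Finset.mem_univ _, rfl⟩
    exact Nat.lt_succ_of_le ((Finset.card_le_univ _).trans_eq (Fintype.card_fin T))
  refine ((Finset.card_le_card hsub).trans Finset.card_image_le).trans_eq ?_
  simp only [Finset.card_univ, Fintype.card_pi, Fintype.card_fin, Finset.prod_const]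
  rw [← pow_mul, mul_comm]

end Likelihood

section Maximizer

variable {nL n T : ℕ} {h : nL ≤ n} {g : Fin T → Fin n → Bool} {z : Fin T → Fin nL}
  {A : Matrix (Fin nL) (Fin n) ℝ}

/-- A hub assignment is feasible if every group contains the hub to which it is assigned; the other
assignments have likelihood `0` under every admissible matrix. -/
def IsFeasible (h : nL ≤ n) (g : Fin T → Fin n → Bool) (z : Fin T → Fin nL) : Prop :=
  ∀ t, g t (Fin.castLE h (z t)) = true

theorem isFeasible_of_lik_ne_zero (hA : A ∈ Admissible h) (hlik : lik g A z ≠ 0) :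
    IsFeasible h g z := by
  intro t
  have hbern := Finset.prod_ne_zero_iff.1 hlik (t, Fin.castLE h (z t)) (Finset.mem_univ _)
  simpa [bern, hA.2] using hbern

theorem IsMaxProfile.condLogLik_le (hz : IsMaxProfile h g z) (hA : A ∈ Admissible h)
    (z₀ : Fin T → Fin nL) : condLogLik g A z₀ ≤ profileLogLik h g z :=
  (le_iSup₂ (f := fun A _ => condLogLik g A z₀) A hA).trans (hz z₀)

theorem IsMaxProfile.isFeasible (hz : IsMaxProfile h g z) (hA : A ∈ Admissible h)
    {z₀ : Fin T → Fin nL} (hpos : 0 < lik g A z₀) : IsFeasible h g z := by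
  have hbot : ⊥ < condLogLik g A z₀ := by
    rw [condLogLik_eq_log_lik hA.1, bot_lt_iff_ne_bot, Ne, ENNReal.log_eq_bot_iff]
    simpa using hpos
  obtain ⟨B, hB, hlt⟩ : ∃ B, ∃ _ : B ∈ Admissible h, ⊥ < condLogLik g B z := by
    simpa only [profileLogLik, lt_iSup_iff] using hbot.trans_le (hz.condLogLik_le hA z₀)
  rw [condLogLik_eq_log_lik hB.1, bot_lt_iff_ne_bot, Ne, ENNReal.log_eq_bot_iff,
    ENNReal.ofReal_eq_zero, not_le] at hlt
  exact isFeasible_of_lik_ne_zero hB hlt.ne'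

theorem IsMaxProfile.lik_le (hz : IsMaxProfile h g z) (hA : A ∈ Admissible h)
    (z₀ : Fin T → Fin nL) : lik g A z₀ ≤ lik g (empMatrix g z) z := by
  have hemp := empMatrix_mem_Icc g z
  have hprofile : profileLogLik h g z ≤ condLogLik g (empMatrix g z) z := by
    refine iSup₂_le fun B hB => ?_
    rw [condLogLik_eq_log_lik hB.1, condLogLik_eq_log_lik hemp]
    exact ENNReal.log_monotone (ENNReal.ofReal_le_ofReal (lik_le_lik_empMatrix hB.1 g z))
  have hlog := (hz.condLogLik_le hA z₀).trans hprofile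
  rw [condLogLik_eq_log_lik hA.1, condLogLik_eq_log_lik hemp, ENNReal.log_le_log_iff] at hlog
  exact (ENNReal.ofReal_le_ofReal_iff (lik_nonneg hemp _ _)).1 hlog

end Maximizer

section Separation

variable {nL n T : ℕ} {P : Params nL n} {d v : ℝ}

theorem Separated.le_sum_sq_add_sum_sq (hsep : Separated P d v) (hd : 0 ≤ d) {k k' : Fin nL}
    (hk : k ≠ k') (b : Fin n → ℝ) :
    2 * (d ^ 2 * v * n / (4 * nL)) ≤ ∑ j, (P.A k j - b j) ^ 2 + ∑ j, (P.A k' j - b j) ^ 2 := by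
  obtain ⟨V, hV⟩ := hsep
  have hterm : ∀ j ∈ V k, d ^ 2 / 2 ≤ (P.A k j - b j) ^ 2 + (P.A k' j - b j) ^ 2 := by
    intro j hj
    have hsq := pow_le_pow_left₀ hd ((hV k).2 j hj k' hk) 2
    nlinarith [sq_nonneg (P.A k j - b j + (P.A k' j - b j))]
  rw [← Finset.sum_add_distrib]
  calc 2 * (d ^ 2 * v * n / (4 * nL)) = v * n / nL * (d ^ 2 / 2) := by ring
    _ ≤ #(V k) * (d ^ 2 / 2) := by gcongr; exact (hV k).1
    _ ≤ ∑ j ∈ V k, ((P.A k j - b j) ^ 2 + (P.A k' j - b j) ^ 2) := by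
        rw [← nsmul_eq_mul]; exact Finset.card_nsmul_le_sum _ _ _ hterm
    _ ≤ ∑ j, ((P.A k j - b j) ^ 2 + (P.A k' j - b j) ^ 2) :=
        Finset.sum_le_univ_sum_of_nonneg fun j => by positivity

theorem Separated.exists_forall_ne_le_sum_sq (hsep : Separated P d v) (hd : 0 ≤ d)
    [Nonempty (Fin nL)] (b : Fin n → ℝ) :
    ∃ k, ∀ k', k' ≠ k → d ^ 2 * v * n / (4 * nL) ≤ ∑ j, (P.A k' j - b j) ^ 2 := by
  obtain ⟨k, hk⟩ := Finite.exists_min fun k => ∑ j, (P.A k j - b j) ^ 2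
  refine ⟨k, fun k' hk' => ?_⟩
  have hpair := hsep.le_sum_sq_add_sum_sq hd hk' b
  linarith [hk k']

theorem numErrors_mul_le_sum {z z' : Fin T → Fin nL} {η : ℝ} {S : Fin T → ℝ}
    (hS : ∀ t, 0 ≤ S t) (hη : ∀ t, z t ≠ z' t → η ≤ S t) :
    η * numErrors z z' ≤ ∑ t, S t :=
  calc η * numErrors z z' = ∑ t with z t ≠ z' t, η := by
        rw [Finset.sum_const, nsmul_eq_mul, mul_comm, numErrors]
    _ ≤ ∑ t with z t ≠ z' t, S t :=
        Finset.sum_le_sum fun t ht => hη t (Finset.mem_filter.1 ht).2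
    _ ≤ ∑ t, S t := Finset.sum_le_univ_sum_of_nonneg hS

/-- The relabelling `f` sends `i` to the hub whose row of `A` is nearest to the row `i` of `B`. -/
theorem Separated.exists_numErrors_comp_le (hsep : Separated P d v) (hd : 0 ≤ d)
    (B : Matrix (Fin nL) (Fin n) ℝ) (z₀ z : Fin T → Fin nL) :
    ∃ f : Fin nL → Fin nL, d ^ 2 * v * n / (4 * nL) * numErrors z₀ (f ∘ z)
      ≤ ∑ t, ∑ j, (P.A (z₀ t) j - B (z t) j) ^ 2 := by
  have hnearest : ∀ i, ∃ k, ∀ k', k' ≠ k →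
      d ^ 2 * v * n / (4 * nL) ≤ ∑ j, (P.A k' j - B i j) ^ 2 := fun i =>
    have : Nonempty (Fin nL) := ⟨i⟩
    hsep.exists_forall_ne_le_sum_sq hd (B i)
  choose f hf using hnearest
  exact ⟨f, numErrors_mul_le_sum (fun t => Finset.sum_nonneg fun j _ => sq_nonneg _)
    fun t ht => hf (z t) (z₀ t) ht⟩

end Separation

section Chernoff

variable {Ω α : Type*} [MeasurableSpace Ω] {μ : Measure Ω} {E : α → Set Ω}

theorem mgf_indicator_one_le [IsProbabilityMeasure μ] {S : Set Ω} (hS : MeasurableSet S) (s : ℝ) :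
    mgf (S.indicator fun _ => (1 : ℝ)) μ s ≤ Real.exp ((Real.exp s - 1) * μ.real S) := by
  have hexp : (fun ω => Real.exp (s * S.indicator (fun _ => (1 : ℝ)) ω))
      = fun ω => S.indicator (fun _ => Real.exp s - 1) ω + 1 := by
    ext ω
    by_cases hω : ω ∈ S <;> simp [hω]
  rw [mgf, hexp, integral_add ((integrable_const _).indicator hS) (integrable_const _),
    integral_indicator_const _ hS, integral_const]
  simpa [mul_comm] using Real.add_one_le_exp ((Real.exp s - 1) * μ.real S)

theorem integrable_exp_sum_indicator [Fintype α] (hE : ∀ a, MeasurableSet (E a))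
    (hind : iIndepSet E μ) (s : ℝ) :
    Integrable (fun ω => Real.exp (s * (∑ a, (E a).indicator fun _ => (1 : ℝ)) ω)) μ := by
  have := hind.isProbabilityMeasure
  have hmeas : ∀ a, Measurable ((E a).indicator fun _ => (1 : ℝ)) := fun a =>
    measurable_const.indicator (hE a)
  refine hind.iIndepFun_indicator.integrable_exp_mul_sum hmeas fun a _ =>
    integrable_exp_mul_of_mem_Icc (a := 0) (b := 1) (hmeas a).aemeasurable (ae_of_all _ fun ω => ?_)
  by_cases hω : ω ∈ E a <;> simp [hω]

theorem mgf_sum_indicator_le [Fintype α] (hE : ∀ a, MeasurableSet (E a)) (hind : iIndepSet E μ)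
    (s : ℝ) :
    mgf (∑ a, (E a).indicator fun _ => (1 : ℝ)) μ s
      ≤ Real.exp ((Real.exp s - 1) * ∑ a, μ.real (E a)) := by
  have := hind.isProbabilityMeasure
  rw [hind.iIndepFun_indicator.mgf_sum fun a => measurable_const.indicator (hE a),
    Finset.mul_sum, Real.exp_sum]
  exact Finset.prod_le_prod (fun a _ => mgf_nonneg) fun a _ => mgf_indicator_one_le (hE a) s

theorem measureReal_le_sum_indicator_le [Fintype α] (hE : ∀ a, MeasurableSet (E a))
    (hind : iIndepSet E μ) {M : ℝ} (hM : ∑ a, μ.real (E a) ≤ M) :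
    μ.real {ω | 3 * M ≤ (∑ a, (E a).indicator fun _ => (1 : ℝ)) ω} ≤ Real.exp (-M) := by
  have := hind.isProbabilityMeasure
  have hsum : 0 ≤ ∑ a, μ.real (E a) := Finset.sum_nonneg fun a _ => measureReal_nonneg
  have he := Real.exp_one_lt_three
  calc μ.real {ω | 3 * M ≤ (∑ a, (E a).indicator fun _ => (1 : ℝ)) ω}
      ≤ Real.exp (-1 * (3 * M)) * mgf (∑ a, (E a).indicator fun _ => (1 : ℝ)) μ 1 :=
        measure_ge_le_exp_mul_mgf _ zero_le_one (integrable_exp_sum_indicator hE hind 1)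
    _ ≤ Real.exp (-1 * (3 * M)) * Real.exp ((Real.exp 1 - 1) * ∑ a, μ.real (E a)) := by
        gcongr; exact mgf_sum_indicator_le hE hind 1
    _ ≤ Real.exp (-M) := by
        rw [← Real.exp_add, Real.exp_le_exp]; nlinarith

theorem measureReal_sum_indicator_le_le [Fintype α] (hE : ∀ a, MeasurableSet (E a))
    (hind : iIndepSet E μ) {M : ℝ} (hM : M ≤ ∑ a, μ.real (E a)) :
    μ.real {ω | (∑ a, (E a).indicator fun _ => (1 : ℝ)) ω ≤ M / 4} ≤ Real.exp (-(M / 4)) := by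
  have := hind.isProbabilityMeasure
  have hsum : 0 ≤ ∑ a, μ.real (E a) := Finset.sum_nonneg fun a _ => measureReal_nonneg
  have he : Real.exp (-1) ≤ 1 / 2 := by
    rw [Real.exp_neg, ← one_div]
    exact one_div_le_one_div_of_le two_pos (by linarith [Real.add_one_le_exp 1])
  calc μ.real {ω | (∑ a, (E a).indicator fun _ => (1 : ℝ)) ω ≤ M / 4}
      ≤ Real.exp (-(-1) * (M / 4)) * mgf (∑ a, (E a).indicator fun _ => (1 : ℝ)) μ (-1) :=
        measure_le_le_exp_mul_mgf _ (by norm_num) (integrable_exp_sum_indicator hE hind (-1))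
    _ ≤ Real.exp (-(-1) * (M / 4)) * Real.exp ((Real.exp (-1) - 1) * ∑ a, μ.real (E a)) := by
        gcongr; exact mgf_sum_indicator_le hE hind (-1)
    _ ≤ Real.exp (-(M / 4)) := by
        rw [← Real.exp_add, Real.exp_le_exp]; nlinarith

end Chernoff

section SampleLaw

variable {nL n T : ℕ} {P : Params nL n} {Ω : Type*} [MeasurableSpace Ω] {μ : Measure Ω}
  {zs : Ω → Fin T → Fin nL} {G : Ω → Fin T → Fin n → Bool}

theorem IsSample.measurable_prodMk (hs : IsSample P μ zs G) :
    Measurable fun ω => (zs ω, G ω) :=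
  hs.measurable_zs.prodMk hs.measurable_G

theorem IsSample.measurable_group (hs : IsSample P μ zs G) (t : Fin T) :
    Measurable fun ω => (zs ω t, G ω t) :=
  ((measurable_pi_apply t).comp hs.measurable_zs).prodMk
    ((measurable_pi_apply t).comp hs.measurable_G)

theorem IsSample.measureReal_eq (hs : IsSample P μ zs G) (z : Fin T → Fin nL)
    (g : Fin T → Fin n → Bool) :
    μ.real {ω | zs ω = z ∧ G ω = g} = (∏ t, P.ρ (z t)) * lik g P.A z := by
  have hinter : {ω | zs ω = z ∧ G ω = g}
      = ⋂ t ∈ Finset.univ, (fun ω => (zs ω t, G ω t)) ⁻¹' {(z t, g t)} := by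
    ext ω
    simp [funext_iff, forall_and]
  rw [hinter, measureReal_def, hs.indep.measure_inter_preimage_eq_mul Finset.univ
    fun t _ => measurableSet_singleton _, ENNReal.toReal_prod, lik_eq_prod_bernProd,
    ← Finset.prod_mul_distrib]
  refine Fintype.prod_congr _ _ fun t => ?_
  rw [bernProd, ← hs.law t, measureReal_def]
  congr 2
  ext ω
  simp

theorem IsSample.measureReal_setOf (hs : IsSample P μ zs G)
    (q : (Fin T → Fin nL) → (Fin T → Fin n → Bool) → Prop) [∀ z, DecidablePred (q z)] :
    μ.real {ω | q (zs ω) (G ω)} = ∑ z, (∏ t, P.ρ (z t)) * ∑ g with q z g, lik g P.A z := by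
  have := hs.indep.isProbabilityMeasure
  have hset : {ω | q (zs ω) (G ω)} = (fun ω => (zs ω, G ω)) ⁻¹'
      (Finset.univ.filter fun x : (Fin T → Fin nL) × (Fin T → Fin n → Bool) => q x.1 x.2) := by
    ext ω
    simp
  rw [hset, ← sum_measureReal_preimage_singleton _ fun x _ =>
    hs.measurable_prodMk (measurableSet_singleton x), Finset.sum_filter, Fintype.sum_prod_type]
  refine Fintype.sum_congr _ _ fun z => ?_
  rw [Finset.mul_sum, Finset.sum_filter]
  refine Fintype.sum_congr _ _ fun g => ?_
  rw [← hs.measureReal_eq]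
  simp [Set.preimage]

theorem IsSample.ae_lik_pos (hs : IsSample P μ zs G) :
    ∀ᵐ ω ∂μ, 0 < lik (G ω) P.A (zs ω) := by
  classical
  have hzero : μ.real {ω | ¬ 0 < lik (G ω) P.A (zs ω)} = 0 := by
    rw [hs.measureReal_setOf fun z g => ¬ 0 < lik g P.A z]
    refine Finset.sum_eq_zero fun z _ => mul_eq_zero_of_right _ (Finset.sum_eq_zero fun g hg => ?_)
    exact le_antisymm (not_lt.1 (Finset.mem_filter.1 hg).2) (lik_nonneg P.A_mem.1 g z)
  have := hs.indep.isProbabilityMeasure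
  exact ae_iff.2 ((measureReal_eq_zero_iff).1 hzero)

theorem IsSample.measureReal_hub_eq (hs : IsSample P μ zs G) (t : Fin T)
    (k : Fin nL) (j : Fin n) (b : Bool) :
    μ.real {ω | zs ω t = k ∧ G ω t j = b} = P.ρ k * bern (P.A k j) b := by
  have := hs.indep.isProbabilityMeasure
  have hset : {ω | zs ω t = k ∧ G ω t j = b} = (fun ω => (zs ω t, G ω t)) ⁻¹'
      (({k} ×ˢ Finset.univ.filter fun g : Fin n → Bool => g j = b : Finset _) : Set _) := by
    ext ω
    simp [and_comm, eq_comm]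
  rw [hset, ← sum_measureReal_preimage_singleton _ fun x _ =>
    hs.measurable_group t (measurableSet_singleton x), Finset.sum_product, Finset.sum_singleton,
    ← sum_bernProd_filter_eq, Finset.mul_sum]
  refine Finset.sum_congr rfl fun g _ => ?_
  rw [bernProd, ← hs.law t]
  simp [Set.preimage]

theorem IsSample.measurableSet_hub (hs : IsSample P μ zs G) (t : Fin T) (k : Fin nL) (j : Fin n)
    (b : Bool) : MeasurableSet {ω | zs ω t = k ∧ G ω t j = b} :=
  hs.measurable_group t
    (MeasurableSet.of_discrete (s := {y : Fin nL × (Fin n → Bool) | y.1 = k ∧ y.2 j = b}))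

theorem IsSample.iIndepSet_hub (hs : IsSample P μ zs G) (k : Fin nL) (j : Fin n) (b : Bool) :
    iIndepSet (fun t => {ω | zs ω t = k ∧ G ω t j = b}) μ :=
  (iIndepSet_iff_meas_biInter fun t => hs.measurableSet_hub t k j b).2 fun s =>
    hs.indep.measure_inter_preimage_eq_mul s
      (sets := fun _ => {y : Fin nL × (Fin n → Bool) | y.1 = k ∧ y.2 j = b})
      fun _ _ => MeasurableSet.of_discrete

end SampleLaw

section UnionBound

variable {nL n T : ℕ} {P : Params nL n} {Ω : Type*} [MeasurableSpace Ω] {μ : Measure Ω}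
  {zs : Ω → Fin T → Fin nL} {G : Ω → Fin T → Fin n → Bool} {d v : ℝ}

theorem IsSample.measureReal_lik_le_lik_le (hs : IsSample P μ zs G) (hd : 0 ≤ d) (hv : 0 ≤ v)
    (hsep : Separated P d v) {B : Matrix (Fin nL) (Fin n) ℝ}
    (hB : ∀ i j, B i j ∈ Set.Icc (0 : ℝ) 1) (z : Fin T → Fin nL) (D : ℝ) :
    μ.real {ω | (∀ f : Fin nL → Fin nL, D ≤ numErrors (zs ω) (f ∘ z)) ∧
        lik (G ω) P.A (zs ω) ≤ lik (G ω) B z}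
      ≤ Real.exp (-(d ^ 2 * v * n / (32 * nL) * D)) := by
  classical
  have hρ : ∑ z : Fin T → Fin nL, ∏ t, P.ρ (z t) = 1 := by
    rw [← Fintype.sum_pow, P.ρ_sum, one_pow]
  rw [hs.measureReal_setOf fun z₀ g =>
    (∀ f : Fin nL → Fin nL, D ≤ numErrors z₀ (f ∘ z)) ∧ lik g P.A z₀ ≤ lik g B z]
  rw [← one_mul (Real.exp _), ← hρ, Finset.sum_mul]
  refine Finset.sum_le_sum fun z₀ _ =>
    mul_le_mul_of_nonneg_left ?_ (Finset.prod_nonneg fun t _ => P.ρ_nonneg _)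
  by_cases hfar : ∀ f : Fin nL → Fin nL, D ≤ numErrors z₀ (f ∘ z)
  · simp only [hfar, implies_true, true_and]
    refine (sum_filter_lik_le_exp P.A_mem.1 hB z₀ z).trans (Real.exp_le_exp.2 ?_)
    obtain ⟨f, hf⟩ := hsep.exists_numErrors_comp_le hd B z₀ z
    have hD : d ^ 2 * v * n / (4 * nL) * D ≤ d ^ 2 * v * n / (4 * nL) * numErrors z₀ (f ∘ z) := by
      gcongr; exact hfar f
    calc -(∑ t, ∑ j, (P.A (z₀ t) j - B (z t) j) ^ 2) / 8
        ≤ -(d ^ 2 * v * n / (4 * nL) * D) / 8 := by linarith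
      _ = -(d ^ 2 * v * n / (32 * nL) * D) := by ring
  · simp only [hfar, false_and, Finset.filter_false, Finset.sum_empty]
    positivity

theorem IsSample.measureReal_exists_lik_le_lik_le (hs : IsSample P μ zs G) (hd : 0 ≤ d)
    (hv : 0 ≤ v) (hsep : Separated P d v) (D : ℝ) :
    μ.real {ω | ∃ z, (∀ f : Fin nL → Fin nL, D ≤ numErrors (zs ω) (f ∘ z)) ∧
        lik (G ω) P.A (zs ω) ≤ lik (G ω) (empMatrix (G ω) z) z}
      ≤ (nL : ℝ) ^ T * (T + 1 : ℝ) ^ (nL * n) * Real.exp (-(d ^ 2 * v * n / (32 * nL) * D)) := by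
  classical
  have := hs.indep.isProbabilityMeasure
  set r := Real.exp (-(d ^ 2 * v * n / (32 * nL) * D))
  let E (B : Matrix (Fin nL) (Fin n) ℝ) (z : Fin T → Fin nL) : Set Ω :=
    {ω | (∀ f : Fin nL → Fin nL, D ≤ numErrors (zs ω) (f ∘ z)) ∧
      lik (G ω) P.A (zs ω) ≤ lik (G ω) B z}
  let F (z : Fin T → Fin nL) : Finset (Matrix (Fin nL) (Fin n) ℝ) :=
    Finset.univ.image fun g : Fin T → Fin n → Bool => empMatrix g z
  have hE : ∀ z, ∀ B ∈ F z, μ.real (E B z) ≤ r := by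
    intro z B hB
    obtain ⟨g, -, rfl⟩ := Finset.mem_image.1 hB
    exact hs.measureReal_lik_le_lik_le hd hv hsep (empMatrix_mem_Icc g z) z D
  calc μ.real {ω | ∃ z, (∀ f : Fin nL → Fin nL, D ≤ numErrors (zs ω) (f ∘ z)) ∧
        lik (G ω) P.A (zs ω) ≤ lik (G ω) (empMatrix (G ω) z) z}
      ≤ μ.real (⋃ z, ⋃ B ∈ F z, E B z) := by
        refine measureReal_mono fun ω ⟨z, hω⟩ => Set.mem_iUnion.2 ⟨z, Set.mem_iUnion₂.2 ?_⟩
        exact ⟨_, Finset.mem_image_of_mem _ (Finset.mem_univ (G ω)), hω⟩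
    _ ≤ ∑ z, ∑ B ∈ F z, μ.real (E B z) :=
        (measureReal_iUnion_fintype_le _).trans
          (Finset.sum_le_sum fun z _ => measureReal_biUnion_finset_le _ _)
    _ ≤ ∑ _z : Fin T → Fin nL, (T + 1 : ℝ) ^ (nL * n) * r := by
        refine Finset.sum_le_sum fun z _ => (Finset.sum_le_card_nsmul _ _ _ (hE z)).trans ?_
        rw [nsmul_eq_mul]
        gcongr
        exact_mod_cast card_image_empMatrix_le z
    _ = (nL : ℝ) ^ T * (T + 1 : ℝ) ^ (nL * n) * r := by simp [mul_assoc]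

/-- A maximizer that makes too many errors is feasible and beats the true assignment; outside `N`
it is also far from every relabelling of the true hubs, which the union bound makes unlikely. -/
theorem IsSample.measureReal_numErrors_le (hs : IsSample P μ zs G) {zhat : Ω → Fin T → Fin nL}
    (hzhat : ∀ᵐ ω ∂μ, IsMaxProfile P.le (G ω) (zhat ω)) (hd : 0 ≤ d) (hv : 0 ≤ v)
    (hsep : Separated P d v) (N : Set Ω) (ε D : ℝ)
    (hN : ∀ ω ∉ N, ∀ z, IsFeasible P.le (G ω) z → ε ≤ numErrors (zs ω) z / T →
      ∀ f : Fin nL → Fin nL, D ≤ numErrors (zs ω) (f ∘ z)) :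
    μ.real {ω | ε ≤ numErrors (zs ω) (zhat ω) / T} ≤ μ.real N +
      (nL : ℝ) ^ T * (T + 1 : ℝ) ^ (nL * n) * Real.exp (-(d ^ 2 * v * n / (32 * nL) * D)) := by
  have := hs.indep.isProbabilityMeasure
  refine le_trans ?_ ((measureReal_union_le N _).trans
    (add_le_add_right (hs.measureReal_exists_lik_le_lik_le hd hv hsep D) _))
  refine ENNReal.toReal_mono (measure_ne_top _ _) (measure_mono_ae ?_)
  filter_upwards [hzhat, hs.ae_lik_pos] with ω hmax hpos herr
  by_cases hω : ω ∈ N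
  · exact Or.inl hω
  · exact Or.inr ⟨zhat ω, hN ω hω _ (hmax.isFeasible P.A_mem hpos) herr,
      hmax.lik_le P.A_mem (zs ω)⟩

end UnionBound

section HubCount

variable {nL n T : ℕ} {h : nL ≤ n} {g : Fin T → Fin n → Bool} {z₀ z : Fin T → Fin nL} {M : ℝ}

/-- The number of groups with hub `k` that contain (`b = true`) or do not contain (`b = false`) the
hub `i`. -/
def hubCount (h : nL ≤ n) (b : Bool) (g : Fin T → Fin n → Bool) (z : Fin T → Fin nL)
    (k i : Fin nL) : ℕ :=
  #{t | z t = k ∧ g t (Fin.castLE h i) = b}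

theorem numErrors_le_numErrors_comp_add (hz : IsFeasible h g z) (f : Fin nL → Fin nL) :
    numErrors z₀ z ≤ numErrors z₀ (f ∘ z) + ∑ i with f i ≠ i, hubCount h true g z₀ (f i) i := by
  have hsub : ({t | z₀ t ≠ z t} : Finset (Fin T)) ⊆
      ({t | z₀ t ≠ (f ∘ z) t} : Finset (Fin T)) ∪ Finset.biUnion {i | f i ≠ i} fun i =>
        {t | z₀ t = f i ∧ g t (Fin.castLE h i) = true} := by
    intro t ht
    simp only [Finset.mem_union, Finset.mem_biUnion, Finset.mem_filter, Finset.mem_univ, true_and]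
      at ht ⊢
    by_cases hft : z₀ t = f (z t)
    · exact Or.inr ⟨z t, fun hfix => ht (hft.trans hfix), hft, hz t⟩
    · exact Or.inl hft
  exact (Finset.card_le_card hsub).trans
    ((Finset.card_union_le _ _).trans (Nat.add_le_add_left Finset.card_biUnion_le _))

theorem numErrors_le_of_forall_hubCount_true_le (hM0 : 0 ≤ M)
    (hM : ∀ k i, k ≠ i → (hubCount h true g z₀ k i : ℝ) ≤ M) (hz : IsFeasible h g z)
    (f : Fin nL → Fin nL) : (numErrors z₀ z : ℝ) ≤ numErrors z₀ (f ∘ z) + nL * M := by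
  have hsum : ∑ i with f i ≠ i, (hubCount h true g z₀ (f i) i : ℝ) ≤ nL * M := by
    refine (Finset.sum_le_card_nsmul _ _ M fun i hi => hM _ _ (Finset.mem_filter.1 hi).2).trans ?_
    rw [nsmul_eq_mul]
    gcongr
    exact (Finset.card_le_univ _).trans_eq (Fintype.card_fin nL)
  calc (numErrors z₀ z : ℝ)
      ≤ numErrors z₀ (f ∘ z) + ∑ i with f i ≠ i, (hubCount h true g z₀ (f i) i : ℝ) := by
        exact_mod_cast numErrors_le_numErrors_comp_add hz f
    _ ≤ numErrors z₀ (f ∘ z) + nL * M := by gcongr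

theorem exists_ne_forall_ne_apply_ne {α : Type*} [Finite α] {f : α → α} (hf : f ≠ id) :
    ∃ k i, k ≠ i ∧ ∀ i', i' ≠ i → f i' ≠ k := by
  obtain ⟨i, hi⟩ := Function.ne_iff.1 hf
  by_cases hsurj : Function.Surjective f
  · have hinj := Finite.injective_iff_surjective.2 hsurj
    exact ⟨f i, i, hi, fun i' hi' heq => hi' (hinj heq)⟩
  · obtain ⟨k, hk⟩ : ∃ k, ∀ i, f i ≠ k := by simpa [Function.Surjective] using hsurj
    have : Nontrivial α := ⟨⟨f i, i, hi⟩⟩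
    obtain ⟨i, hi⟩ := exists_ne k
    exact ⟨k, i, hi.symm, fun i' _ => hk i'⟩

/-- A relabelling other than the identity leaves some hub `k` to at most one label `i ≠ k`, and a
feasible assignment cannot use `i` for the groups with hub `k` that do not contain `i`. -/
theorem le_numErrors_comp_of_forall_le_hubCount_false
    (hM : ∀ k i, k ≠ i → M ≤ hubCount h false g z₀ k i) (hz : IsFeasible h g z)
    {f : Fin nL → Fin nL} (hf : f ≠ id) : M ≤ numErrors z₀ (f ∘ z) := by
  obtain ⟨k, i, hki, hkf⟩ := exists_ne_forall_ne_apply_ne hf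
  refine (hM k i hki).trans (Nat.cast_le.2 (Finset.card_le_card fun t ht => ?_))
  obtain ⟨hk, hi⟩ := (Finset.mem_filter.1 ht).2
  refine Finset.mem_filter.2 ⟨Finset.mem_univ t, fun heq => hkf (z t) ?_ (heq.symm.trans hk)⟩
  rintro rfl
  exact Bool.false_ne_true (hi.symm.trans (hz t))

theorem measureReal_exists_ne_le {α Ω : Type*} [Fintype α] [MeasurableSpace Ω] {μ : Measure Ω}
    (S : α → α → Set Ω) {r : ℝ} (hr : 0 ≤ r) (hS : ∀ k i, k ≠ i → μ.real (S k i) ≤ r) :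
    μ.real {ω | ∃ k i, k ≠ i ∧ ω ∈ S k i} ≤ (Fintype.card α : ℝ) ^ 2 * r := by
  classical
  have hset : {ω | ∃ k i, k ≠ i ∧ ω ∈ S k i}
      = ⋃ q ∈ (Finset.univ : Finset α).offDiag, S q.1 q.2 := by
    ext ω
    simp
  rw [hset]
  refine (measureReal_biUnion_finset_le _ _).trans ((Finset.sum_le_card_nsmul _ _ r
    fun q hq => hS q.1 q.2 (Finset.mem_offDiag.1 hq).2.2).trans ?_)
  rw [nsmul_eq_mul, sq]
  gcongr
  rw [Finset.offDiag_card, Finset.card_univ]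
  exact_mod_cast Nat.sub_le _ _

theorem sum_indicator_eq_hubCount {Ω : Type*} (zs : Ω → Fin T → Fin nL)
    (G : Ω → Fin T → Fin n → Bool) (b : Bool) (k i : Fin nL) (ω : Ω) :
    (∑ t, {ω | zs ω t = k ∧ G ω t (Fin.castLE h i) = b}.indicator fun _ => (1 : ℝ)) ω
      = hubCount h b (G ω) (zs ω) k i := by
  simp [hubCount, Set.indicator_apply]

variable {P : Params nL n} {Ω : Type*} [MeasurableSpace Ω] {μ : Measure Ω}
  {zs : Ω → Fin T → Fin nL} {G : Ω → Fin T → Fin n → Bool}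

theorem IsSample.sum_measureReal_hub_eq (hs : IsSample P μ zs G) (b : Bool) (k i : Fin nL) :
    ∑ t, μ.real {ω | zs ω t = k ∧ G ω t (Fin.castLE P.le i) = b}
      = T * (P.ρ k * bern (P.A k (Fin.castLE P.le i)) b) := by
  simp [hs.measureReal_hub_eq]

theorem IsSample.measureReal_exists_le_hubCount_true (hs : IsSample P μ zs G)
    (hM : ∀ k i, k ≠ i → T * (P.ρ k * P.A k (Fin.castLE P.le i)) ≤ M) :
    μ.real {ω | ∃ k i, k ≠ i ∧ 3 * M ≤ hubCount P.le true (G ω) (zs ω) k i}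
      ≤ (nL : ℝ) ^ 2 * Real.exp (-M) := by
  have hunion := measureReal_exists_ne_le (μ := μ)
    (fun k i => {ω | 3 * M ≤ hubCount P.le true (G ω) (zs ω) k i}) (Real.exp_nonneg (-M)) ?_
  · rwa [Fintype.card_fin] at hunion
  intro k i hki
  have htail := measureReal_le_sum_indicator_le (fun t => hs.measurableSet_hub t k _ true)
    (hs.iIndepSet_hub k _ true) ((hs.sum_measureReal_hub_eq true k i).trans_le (hM k i hki))
  simpa only [sum_indicator_eq_hubCount] using htail

theorem IsSample.measureReal_exists_hubCount_false_le (hs : IsSample P μ zs G)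
    (hM : ∀ k i, k ≠ i → M ≤ T * (P.ρ k * (1 - P.A k (Fin.castLE P.le i)))) :
    μ.real {ω | ∃ k i, k ≠ i ∧ hubCount P.le false (G ω) (zs ω) k i ≤ M / 4}
      ≤ (nL : ℝ) ^ 2 * Real.exp (-(M / 4)) := by
  have hunion := measureReal_exists_ne_le (μ := μ)
    (fun k i => {ω | hubCount P.le false (G ω) (zs ω) k i ≤ M / 4}) (Real.exp_nonneg (-(M / 4))) ?_
  · rwa [Fintype.card_fin] at hunion
  intro k i hki
  have htail := measureReal_sum_indicator_le_le (fun t => hs.measurableSet_hub t k _ false)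
    (hs.iIndepSet_hub k _ false) ((hM k i hki).trans_eq (hs.sum_measureReal_hub_eq false k i).symm)
  simpa only [sum_indicator_eq_hubCount] using htail

end HubCount

section Asymptotics

theorem Params.nL_pos {nL n : ℕ} (P : Params nL n) : 0 < nL := by
  by_contra! h
  obtain rfl := Nat.le_zero.1 h
  simpa using P.ρ_sum

theorem Params.rho_mul_le_mul {nL n : ℕ} (P : Params nL n) {i j : Fin nL} {r b : ℝ} (hρ : P.ρ i ≤ r)
    (hA : P.A i (Fin.castLE P.le j) ≤ b) : P.ρ i * P.A i (Fin.castLE P.le j) ≤ r * b :=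
  mul_le_mul hρ hA (P.A_mem.1 _ _).1 ((P.ρ_nonneg i).trans hρ)

theorem pow_mul_pow_mul_exp_neg_le_one_div {a b T : ℕ} {x : ℝ} (ha : 0 < a) (hb : 0 < b)
    (hx₁ : T * Real.log a ≤ x / 2) (hx₂ : b * Real.log (T + 1) ≤ x / 4) :
    (a : ℝ) ^ T * (T + 1 : ℝ) ^ b * Real.exp (-x) ≤ 1 / (T + 1 : ℝ) := by
  have ha' : (0 : ℝ) < a := Nat.cast_pos.2 ha
  have hT : (0 : ℝ) < T + 1 := by positivity
  have hlog : Real.log (T + 1) ≤ b * Real.log (T + 1) :=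
    le_mul_of_one_le_left (Real.log_nonneg (by simp)) (Nat.one_le_cast.2 hb)
  calc (a : ℝ) ^ T * (T + 1 : ℝ) ^ b * Real.exp (-x)
      = Real.exp (T * Real.log a + b * Real.log (T + 1) + -x) := by
        rw [Real.exp_add, Real.exp_add, Real.exp_nat_mul, Real.exp_nat_mul, Real.exp_log ha',
          Real.exp_log hT]
    _ ≤ Real.exp (-Real.log (T + 1)) := Real.exp_le_exp.2 (by linarith)
    _ = 1 / (T + 1 : ℝ) := by rw [Real.exp_neg, Real.exp_log hT, one_div]

theorem log_natCast_add_one_le_two_mul_log {T : ℕ} (hT : 2 ≤ T) :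
    Real.log (T + 1) ≤ 2 * Real.log T := by
  have hT' : (2 : ℝ) ≤ T := by exact_mod_cast hT
  calc Real.log (T + 1) ≤ Real.log ((T : ℝ) ^ 2) := Real.log_le_log (by linarith) (by nlinarith)
    _ = 2 * Real.log T := by rw [Real.log_pow, Nat.cast_ofNat]

variable {ι : Type*} {l : Filter ι} {nL n T : ι → ℕ}

theorem tendsto_pow_mul_pow_mul_exp_neg_nhds_zero {w : ι → ℝ} {δ : ℝ} (hnL : ∀ k, 0 < nL k)
    (hn : ∀ k, 0 < n k) (hw : ∀ k, 0 < w k) (hδ : 0 < δ) (hT : Tendsto T l atTop)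
    (hwn : Tendsto (fun k => (nL k : ℝ) * Real.log (nL k) / (w k * n k)) l (𝓝 0))
    (hwT : Tendsto (fun k => (nL k : ℝ) ^ 2 * Real.log (T k) / (w k * T k)) l (𝓝 0)) :
    Tendsto (fun k => (nL k : ℝ) ^ T k * (T k + 1 : ℝ) ^ (nL k * n k) *
      Real.exp (-(w k * n k / (32 * nL k) * (δ * T k)))) l (𝓝 0) := by
  refine squeeze_zero' (Eventually.of_forall fun k => by positivity) ?_
    (tendsto_one_div_add_atTop_nhds_zero_nat.comp hT)
  filter_upwards [hwn.eventually_lt_const (by positivity : 0 < δ / 64),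
    hwT.eventually_lt_const (by positivity : 0 < δ / 256), hT.eventually_ge_atTop 2]
    with k hwn hwT hT2
  have ha : (0 : ℝ) < nL k := Nat.cast_pos.2 (hnL k)
  have hN : (0 : ℝ) < n k := Nat.cast_pos.2 (hn k)
  have ht : (0 : ℝ) < T k := Nat.cast_pos.2 (by lia)
  rw [div_lt_iff₀ (mul_pos (hw k) ‹_›)] at hwn hwT
  refine pow_mul_pow_mul_exp_neg_le_one_div (hnL k) (Nat.mul_pos (hnL k) (hn k)) ?_ ?_
  · calc T k * Real.log (nL k) = T k / nL k * (nL k * Real.log (nL k)) := by field_simp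
      _ ≤ T k / nL k * (δ / 64 * (w k * n k)) := by gcongr
      _ = w k * n k / (32 * nL k) * (δ * T k) / 2 := by ring
  · calc ((nL k * n k : ℕ) : ℝ) * Real.log (T k + 1)
        ≤ nL k * n k * (2 * Real.log (T k)) := by
          push_cast
          gcongr
          exact log_natCast_add_one_le_two_mul_log hT2
      _ = 2 * n k / nL k * (nL k ^ 2 * Real.log (T k)) := by field_simp
      _ ≤ 2 * n k / nL k * (δ / 256 * (w k * T k)) := by gcongr
      _ = w k * n k / (32 * nL k) * (δ * T k) / 4 := by ring

theorem tendsto_natCast_sq_mul_exp_neg_mul_div_sq (hnL : Tendsto nL l atTop)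
    (hT : ∀ᶠ k in l, 0 < T k)
    (hlog : Tendsto (fun k => (nL k : ℝ) ^ 2 * Real.log (nL k) / T k) l (𝓝 0)) {C : ℝ}
    (hC : 0 < C) :
    Tendsto (fun k => (nL k : ℝ) ^ 2 * Real.exp (-(C * T k / (nL k : ℝ) ^ 2))) l (𝓝 0) := by
  refine squeeze_zero' (Eventually.of_forall fun k => by positivity) ?_
    (tendsto_one_div_atTop_nhds_zero_nat.comp hnL)
  filter_upwards [hlog.eventually_lt_const (by positivity : 0 < C / 3), hT,
    hnL.eventually_gt_atTop 0] with k hk hTk hnLk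
  have ha : (0 : ℝ) < nL k := Nat.cast_pos.2 hnLk
  rw [div_lt_iff₀ (Nat.cast_pos.2 hTk)] at hk
  have hexp : 3 * Real.log (nL k) ≤ C * T k / (nL k : ℝ) ^ 2 := by
    rw [le_div_iff₀ (by positivity)]
    linarith
  calc (nL k : ℝ) ^ 2 * Real.exp (-(C * T k / (nL k : ℝ) ^ 2))
      ≤ (nL k : ℝ) ^ 2 * Real.exp (-(3 * Real.log (nL k))) := by gcongr
    _ = 1 / (nL k : ℝ) := by
        rw [Real.exp_neg, ← Nat.cast_ofNat (R := ℝ), Real.exp_nat_mul, Real.exp_log ha]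
        field_simp

section Consistency

variable {P : ∀ k, Params (nL k) (n k)} {Ω : ι → Type*} [∀ k, MeasurableSpace (Ω k)]
  {μ : ∀ k, Measure (Ω k)} {zs : ∀ k, Ω k → Fin (T k) → Fin (nL k)}
  {G : ∀ k, Ω k → Fin (T k) → Fin (n k) → Bool} {zhat : ∀ k, Ω k → Fin (T k) → Fin (nL k)}
  {d v : ι → ℝ} {ε : ℝ}

variable (hs : ∀ k, IsSample (P k) (μ k) (zs k) (G k))
  (hzhat : ∀ k, ∀ᵐ ω ∂(μ k), IsMaxProfile (P k).le (G k ω) (zhat k ω))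
  (hd : ∀ k, 0 < d k) (hv : ∀ k, 0 < v k) (hsep : ∀ k, Separated (P k) (d k) (v k))
  (hT : Tendsto T l atTop)
  (hlog : Tendsto (fun k => (nL k : ℝ) * Real.log (nL k) / (d k ^ 2 * v k * n k)) l (𝓝 0))
  (hlogT : Tendsto (fun k => (nL k : ℝ) ^ 2 * Real.log (T k) / (d k ^ 2 * v k * T k)) l (𝓝 0))

include hs hzhat hd hv hsep hT hlog hlogT

theorem tendsto_measure_numErrors {δ : ℝ} (hδ : 0 < δ) (N : ∀ k, Set (Ω k))
    (hN0 : Tendsto (fun k => (μ k).real (N k)) l (𝓝 0))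
    (hN : ∀ᶠ k in l, ∀ ω ∉ N k, ∀ z, IsFeasible (P k).le (G k ω) z →
      ε ≤ numErrors (zs k ω) z / T k →
      ∀ f : Fin (nL k) → Fin (nL k), δ * T k ≤ numErrors (zs k ω) (f ∘ z)) :
    Tendsto (fun k => μ k {ω | ε ≤ (numErrors (zs k ω) (zhat k ω) : ℝ) / T k}) l (𝓝 0) := by
  have := fun k => (hs k).indep.isProbabilityMeasure
  have hunion := tendsto_pow_mul_pow_mul_exp_neg_nhds_zero (fun k => (P k).nL_pos)
    (fun k => (P k).nL_pos.trans_le (P k).le) (fun k => mul_pos (pow_pos (hd k) 2) (hv k)) hδ hT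
    hlog hlogT
  have hsum := hN0.add hunion
  rw [add_zero] at hsum
  have hreal := squeeze_zero' (Eventually.of_forall fun k => measureReal_nonneg)
    (hN.mono fun k hk =>
      (hs k).measureReal_numErrors_le (hzhat k) (hd k).le (hv k).le (hsep k) _ ε _ hk) hsum
  simpa only [ENNReal.ofReal_zero] using
    (ENNReal.tendsto_ofReal hreal).congr fun k => ofReal_measureReal

theorem tendsto_measure_numErrors_of_tendsto_atTop (hnL : Tendsto nL l atTop)
    (hnLT : Tendsto (fun k => (nL k : ℝ) ^ 2 * Real.log (nL k) / T k) l (𝓝 0))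
    {cmax c₀ : ℝ} (hρ : ∀ k i, (P k).ρ i ≤ cmax / nL k)
    (hc₀ : ∀ k, HubBound (P k) (c₀ / nL k)) (hε : 0 < ε) :
    Tendsto (fun k => μ k {ω | ε ≤ (numErrors (zs k ω) (zhat k ω) : ℝ) / T k}) l (𝓝 0) := by
  obtain ⟨C, hC0, hC⟩ : ∃ C : ℝ, 0 < C ∧ cmax * c₀ ≤ C :=
    ⟨max (cmax * c₀) 1, by positivity, le_max_left _ _⟩
  let M (k : ι) : ℝ := C * T k / (nL k : ℝ) ^ 2
  have ha (k : ι) : (0 : ℝ) < nL k := Nat.cast_pos.2 (P k).nL_pos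
  have hM (k : ι) (i j : Fin (nL k)) (hij : i ≠ j) :
      T k * ((P k).ρ i * (P k).A i (Fin.castLE (P k).le j)) ≤ M k :=
    calc T k * ((P k).ρ i * (P k).A i (Fin.castLE (P k).le j))
        ≤ T k * (cmax / nL k * (c₀ / nL k)) :=
          mul_le_mul_of_nonneg_left ((P k).rho_mul_le_mul (hρ k i) (hc₀ k i j hij))
            (Nat.cast_nonneg _)
      _ = cmax * c₀ * T k / (nL k : ℝ) ^ 2 := by ring
      _ ≤ M k := by simp only [M]; gcongr
  refine tendsto_measure_numErrors hs hzhat hd hv hsep hT hlog hlogT (half_pos hε)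
    (fun k => {ω | ∃ i j, i ≠ j ∧ 3 * M k ≤ hubCount (P k).le true (G k ω) (zs k ω) i j}) ?_ ?_
  · have := fun k => (hs k).indep.isProbabilityMeasure
    exact squeeze_zero (fun k => measureReal_nonneg)
      (fun k => (hs k).measureReal_exists_le_hubCount_true (hM k))
      (tendsto_natCast_sq_mul_exp_neg_mul_div_sq hnL (hT.eventually_gt_atTop 0) hnLT hC0)
  · have hsmall (k : ι) (hak : 6 * C / ε ≤ nL k) : nL k * (3 * M k) ≤ ε / 2 * T k := by
      have := ha k
      rw [div_le_iff₀ hε] at hak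
      calc nL k * (3 * M k) = 6 * C * T k / (2 * nL k) := by simp only [M]; field_simp; ring
        _ ≤ nL k * ε * T k / (2 * nL k) := by gcongr
        _ = ε / 2 * T k := by field_simp
    filter_upwards [hT.eventually_gt_atTop 0,
      (tendsto_natCast_atTop_atTop.comp hnL).eventually_ge_atTop (6 * C / ε)]
      with k hTk hak ω hω z hz herr f
    have hfew := numErrors_le_of_forall_hubCount_true_le (by positivity)
      (fun i j hij => (not_le.1 fun hle => hω ⟨i, j, hij, hle⟩).le) hz f
    rw [le_div_iff₀ (Nat.cast_pos.2 hTk)] at herr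
    have := hsmall k hak
    linarith

theorem tendsto_measure_numErrors_of_forall_le {m : ℕ} (hm : ∀ k, nL k ≤ m) {cmin c : ℝ}
    (hcmin : 0 < cmin) (hρ : ∀ k i, cmin / nL k ≤ (P k).ρ i) (hc1 : c < 1)
    (hc : ∀ k, HubBound (P k) c) (hε : 0 < ε) :
    Tendsto (fun k => μ k {ω | ε ≤ (numErrors (zs k ω) (zhat k ω) : ℝ) / T k}) l (𝓝 0) := by
  have : 0 < 1 - c := sub_pos.2 hc1
  let q : ℝ := cmin / (m + 1) * (1 - c)
  have hq0 : 0 < q := by positivity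
  have hM (k : ι) (i j : Fin (nL k)) (hij : i ≠ j) :
      T k * q ≤ T k * ((P k).ρ i * (1 - (P k).A i (Fin.castLE (P k).le j))) := by
    have ha : (0 : ℝ) < nL k := Nat.cast_pos.2 (P k).nL_pos
    have hm' : (nL k : ℝ) ≤ m + 1 := by exact_mod_cast (hm k).trans m.le_succ
    have hρi : cmin / (m + 1) ≤ (P k).ρ i :=
      (div_le_div_of_nonneg_left hcmin.le ha hm').trans (hρ k i)
    simp only [q]
    gcongr
    exacts [(P k).ρ_nonneg i, hc k i j hij]
  refine tendsto_measure_numErrors hs hzhat hd hv hsep hT hlog hlogT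
    (lt_min hε (by positivity : 0 < q / 4))
    (fun k => {ω | ∃ i j, i ≠ j ∧ hubCount (P k).le false (G k ω) (zs k ω) i j ≤ T k * q / 4})
    ?_ ?_
  · have hexp : Tendsto (fun k => (m : ℝ) ^ 2 * Real.exp (-(T k * q / 4))) l (𝓝 0) := by
      have hTq : Tendsto (fun k => (T k : ℝ) * q / 4) l atTop :=
        ((tendsto_natCast_atTop_atTop.comp hT).atTop_mul_const hq0).atTop_div_const (by norm_num)
      simpa using (Real.tendsto_exp_neg_atTop_nhds_zero.comp hTq).const_mul ((m : ℝ) ^ 2)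
    refine squeeze_zero (fun k => measureReal_nonneg) (fun k => ?_) hexp
    refine ((hs k).measureReal_exists_hubCount_false_le (hM k)).trans ?_
    gcongr
    exact hm k
  · filter_upwards [hT.eventually_gt_atTop 0] with k hTk ω hω z hz herr f
    rw [le_div_iff₀ (Nat.cast_pos.2 hTk)] at herr
    obtain rfl | hf := eq_or_ne f id
    · exact (mul_le_mul_of_nonneg_right (min_le_left _ _) (Nat.cast_nonneg _)).trans herr
    · calc min ε (q / 4) * T k ≤ q / 4 * T k := by gcongr; exact min_le_right _ _
        _ = T k * q / 4 := by ring
        _ ≤ numErrors (zs k ω) (f ∘ z) := le_numErrors_comp_of_forall_le_hubCount_false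
            (fun i j hij => (not_le.1 fun hle => hω ⟨i, j, hij, hle⟩).le) hz hf

end Consistency

section Rates

theorem tendsto_log_natCast_div_nhds_zero (hn : Tendsto n l atTop) :
    Tendsto (fun k => Real.log (n k) / n k) l (𝓝 0) :=
  Real.isLittleO_log_id_atTop.tendsto_div_nhds_zero.comp (tendsto_natCast_atTop_atTop.comp hn)

theorem tendsto_log_div_const_mul (hn : Tendsto n l atTop) (c : ℝ) :
    Tendsto (fun k => Real.log (n k) / (c * n k)) l (𝓝 0) := by
  simpa [div_div, mul_comm] using (tendsto_log_natCast_div_nhds_zero hn).div_const c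

theorem tendsto_mul_atTop_of_forall_eq {x : ι → ℝ} {x₀ : ℝ} (hx : ∀ k, x k = x₀)
    (hpos : ∀ k, 0 < x k) (hn : Tendsto n l atTop) :
    Tendsto (fun k => x k * n k) l atTop := by
  obtain hι | ⟨⟨k₀⟩⟩ := isEmpty_or_nonempty ι
  · simp [filter_eq_bot_of_isEmpty l]
  simp only [hx]
  exact (tendsto_natCast_atTop_atTop.comp hn).const_mul_atTop ((hpos k₀).trans_eq (hx k₀))

theorem tendsto_mul_log_div_of_tendsto_sq {x : ι → ℝ} (hx : ∀ k, 0 ≤ x k)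
    (hnL : ∀ k, 0 < nL k) (hle : ∀ k, nL k ≤ n k) (hn : Tendsto n l atTop)
    (hlog : Tendsto (fun k => (nL k : ℝ) ^ 2 * Real.log (nL k) / (x k ^ 2 * n k)) l (𝓝 0)) :
    Tendsto (fun k => (nL k : ℝ) * Real.log (nL k) / (x k * n k)) l (𝓝 0) := by
  have hsum := hlog.add (tendsto_log_natCast_div_nhds_zero hn)
  rw [add_zero] at hsum
  refine squeeze_zero (fun k => ?_) (fun k => ?_) hsum
  · have := hx k
    positivity
  have ha : (0 : ℝ) < nL k := Nat.cast_pos.2 (hnL k)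
  have hamgm (u : ℝ) : u ≤ u ^ 2 + 1 := by nlinarith [sq_nonneg (u - 1)]
  calc (nL k : ℝ) * Real.log (nL k) / (x k * n k)
      = nL k / x k * (Real.log (nL k) / n k) := by rw [div_mul_div_comm]
    _ ≤ ((nL k / x k) ^ 2 + 1) * (Real.log (nL k) / n k) := by gcongr; exact hamgm _
    _ = (nL k : ℝ) ^ 2 * Real.log (nL k) / (x k ^ 2 * n k) + Real.log (nL k) / n k := by
        rw [add_mul, one_mul, div_pow, div_mul_div_comm]
    _ ≤ (nL k : ℝ) ^ 2 * Real.log (nL k) / (x k ^ 2 * n k) + Real.log (n k) / n k := by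
        gcongr
        exact hle k

end Rates

end Asymptotics

end HubModel

end

theorem theorem4_general {ι : Type*} {l : Filter ι} {nL n T : ι → ℕ}
    {P : ∀ k, HubModel.Params (nL k) (n k)}
    {Ω : ι → Type*} [∀ k, MeasurableSpace (Ω k)] {μ : ∀ k, Measure (Ω k)}
    {zs : ∀ k, Ω k → Fin (T k) → Fin (nL k)}
    {G : ∀ k, Ω k → Fin (T k) → Fin (n k) → Bool}
    (hsample : ∀ k, HubModel.IsSample (P k) (μ k) (zs k) (G k))
    {zhat : ∀ k, Ω k → Fin (T k) → Fin (nL k)}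
    (hzhat : ∀ k, ∀ᵐ ω ∂(μ k), HubModel.IsMaxProfile (P k).le (G k ω) (zhat k ω))
    {d v : ι → ℝ} (hd : ∀ k, 0 < d k) (hv : ∀ k, 0 < v k)
    (hsep : ∀ k, HubModel.Separated (P k) (d k) (v k)) (hT : Tendsto T l atTop)
    (hlog : Tendsto (fun k => (nL k : ℝ) * Real.log (nL k) / (d k ^ 2 * v k * n k)) l (𝓝 0))
    (hlogT : Tendsto (fun k => (nL k : ℝ) ^ 2 * Real.log (T k) / (d k ^ 2 * v k * T k)) l (𝓝 0))
    (hregime :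
      (Tendsto nL l atTop ∧
        Tendsto (fun k => (nL k : ℝ) ^ 2 * Real.log (nL k) / T k) l (𝓝 0) ∧
        ∃ cmax c₀ : ℝ, ∀ k, (∀ i, (P k).ρ i ≤ cmax / nL k) ∧ HubModel.HubBound (P k) (c₀ / nL k)) ∨
      ((∃ m : ℕ, ∀ k, nL k ≤ m) ∧
        ∃ cmin > 0, ∃ c < 1, ∀ k, (∀ i, cmin / nL k ≤ (P k).ρ i) ∧ HubModel.HubBound (P k) c))
    (ε : ℝ) (hε : 0 < ε) :
    Tendsto (fun k => μ k {ω | ε ≤ (HubModel.numErrors (zs k ω) (zhat k ω) : ℝ) / T k})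
      l (𝓝 0) := by
  rcases hregime with ⟨hnL, hnLT, cmax, c₀, hP⟩ | ⟨⟨m, hm⟩, cmin, hcmin, c, hc, hP⟩
  · exact HubModel.tendsto_measure_numErrors_of_tendsto_atTop hsample hzhat hd hv hsep hT hlog
      hlogT hnL hnLT (fun k => (hP k).1) (fun k => (hP k).2) hε
  · exact HubModel.tendsto_measure_numErrors_of_forall_le hsample hzhat hd hv hsep hT hlog hlogT
      hm hcmin (fun k => (hP k).1) hc (fun k => (hP k).2) hε

theorem theorem4 {ι : Type*} (l : Filter ι) (nL n T : ι → ℕ)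
    (P : ∀ k, HubModel.Params (nL k) (n k))
    (Ω : ι → Type*) [∀ k, MeasurableSpace (Ω k)]
    (μ : ∀ k, Measure (Ω k)) [∀ k, IsProbabilityMeasure (μ k)]
    (zs : ∀ k, Ω k → Fin (T k) → Fin (nL k))
    (G : ∀ k, Ω k → Fin (T k) → Fin (n k) → Bool)
    (hsample : ∀ k, HubModel.IsSample (P k) (μ k) (zs k) (G k))
    (zhat : ∀ k, Ω k → Fin (T k) → Fin (nL k))
    (hzhat : ∀ k, ∀ᵐ ω ∂(μ k), HubModel.IsMaxProfile (P k).le (G k ω) (zhat k ω))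
    (cmin cmax : ℝ) (hcmin : 0 < cmin)
    (hρ : ∀ k i, cmin / nL k ≤ (P k).ρ i ∧ (P k).ρ i ≤ cmax / nL k)
    (d v : ι → ℝ) (hd : ∀ k, 0 < d k) (hv : ∀ k, 0 < v k)
    (hsep : ∀ k, HubModel.Separated (P k) (d k) (v k))
    (hn : Tendsto n l atTop) (hT : Tendsto T l atTop) :
    -- growing number of hubs
    (Tendsto nL l atTop →
      (∃ c₀ : ℝ, 0 < c₀ ∧ ∀ k, HubModel.HubBound (P k) (c₀ / nL k)) →
      Tendsto (fun k => (nL k : ℝ) ^ 2 * Real.log (nL k) / T k) l (𝓝 0) →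
      Tendsto (fun k => (nL k : ℝ) ^ 2 * Real.log (T k) / (d k ^ 2 * v k * T k)) l (𝓝 0) →
      Tendsto (fun k => (nL k : ℝ) ^ 2 * Real.log (nL k) / (d k ^ 4 * v k ^ 2 * n k)) l (𝓝 0) →
      ∀ ε : ℝ, 0 < ε → Tendsto
        (fun k => μ k {ω | ε ≤ (HubModel.numErrors (zs k ω) (zhat k ω) : ℝ) / T k}) l (𝓝 0)) ∧
    -- fixed number of hubs
    ((∃ m : ℕ, ∀ k, nL k = m) →
      (∃ c : ℝ, c < 1 ∧ ∀ k, HubModel.HubBound (P k) c) →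
      Tendsto (fun k => Real.log (T k) / (d k ^ 2 * v k * T k)) l (𝓝 0) →
      Tendsto (fun k => d k ^ 4 * v k ^ 2 * (n k : ℝ)) l atTop →
      ∀ ε : ℝ, 0 < ε → Tendsto
        (fun k => μ k {ω | ε ≤ (HubModel.numErrors (zs k ω) (zhat k ω) : ℝ) / T k}) l (𝓝 0)) ∧
    -- fixed number of hubs, constant `d` and `v`
    ((∃ m : ℕ, ∀ k, nL k = m) →
      (∃ c : ℝ, c < 1 ∧ ∀ k, HubModel.HubBound (P k) c) →
      (∃ d₀ : ℝ, ∀ k, d k = d₀) → (∃ v₀ : ℝ, ∀ k, v k = v₀) →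
      ∀ ε : ℝ, 0 < ε → Tendsto
        (fun k => μ k {ω | ε ≤ (HubModel.numErrors (zs k ω) (zhat k ω) : ℝ) / T k}) l (𝓝 0)) := by
  have hlog := HubModel.tendsto_mul_log_div_of_tendsto_sq (x := fun k => d k ^ 2 * v k)
    (fun k => mul_nonneg (sq_nonneg _) (hv k).le) (fun k => (P k).nL_pos) (fun k => (P k).le) hn
  have general := theorem4_general hsample hzhat hd hv hsep hT
  simp only [mul_pow, ← pow_mul] at hlog
  have fixed {m : ℕ} (hm : ∀ k, nL k = m) {c : ℝ} (hc1 : c < 1)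
      (hc : ∀ k, HubModel.HubBound (P k) c)
      (hT' : Tendsto (fun k => Real.log (T k) / (d k ^ 2 * v k * T k)) l (𝓝 0))
      (hn' : Tendsto (fun k => d k ^ 4 * v k ^ 2 * (n k : ℝ)) l atTop) :=
    general (hlog (by simpa only [hm] using hn'.const_div_atTop _))
      (by simpa [hm, mul_div_assoc] using hT'.const_mul ((m : ℝ) ^ 2))
      (Or.inr ⟨⟨m, fun k => (hm k).le⟩, cmin, hcmin, c, hc1, fun k => ⟨fun i => (hρ k i).1, hc k⟩⟩)
  exact ⟨fun hnL ⟨c₀, _, hc₀⟩ hnLT hlogT hlog' => general (hlog hlog') hlogT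
      (Or.inl ⟨hnL, hnLT, cmax, c₀, fun k => ⟨fun i => (hρ k i).2, hc₀ k⟩⟩),
    fun ⟨_, hm⟩ ⟨_, hc1, hc⟩ => fixed hm hc1 hc,
    fun ⟨_, hm⟩ ⟨_, hc1, hc⟩ ⟨d₀, hd₀⟩ ⟨v₀, hv₀⟩ => fixed hm hc1 hc
      (by simpa only [hd₀, hv₀] using HubModel.tendsto_log_div_const_mul hT (d₀ ^ 2 * v₀))
      (HubModel.tendsto_mul_atTop_of_forall_eq (x₀ := d₀ ^ 4 * v₀ ^ 2)
        (fun k => by rw [hd₀, hv₀]) (fun k => by have := hd k; have := hv k; positivity) hn)⟩
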